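/- For a finite set $A\subset\mathbb{R}$, let $A+A=\{a+b : a,b\in A\}$ and let $T(A)$ be the number of ordered pairs $(X,Y)$ of $2\times 2$ matrices, all of whose entries lie in $A$, such that $XY=YX$. There is an absolute constant $C>0$ such that for every real $K>1$ and every finite, non-empty set $A\subset\mathbb{R}$ with $|A+A|=K|A|$, one has \[ K^{-1}|A|^5 \le T(A) \le C\,K^{4/3}|A|^5 . \] -/

import Mathlib

open scoped Pointwise

/-- The finite set of all `2 × 2` real matrices whose four entries all lie in `A`. -/
def matricesWithEntries (A : Finset ℝ) : Finset (Matrix (Fin 2) (Fin 2) ℝ) :=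
  (Fintype.piFinset fun _ : Fin 2 => Fintype.piFinset fun _ : Fin 2 => A).map
    Matrix.of.toEmbedding

theorem mem_matricesWithEntries {A : Finset ℝ} {X : Matrix (Fin 2) (Fin 2) ℝ} :
    X ∈ matricesWithEntries A ↔ ∀ i j, X i j ∈ A := by
  simp only [matricesWithEntries, Finset.mem_map, Fintype.mem_piFinset, Equiv.coe_toEmbedding]
  constructor
  · rintro ⟨f, hf, rfl⟩ i j
    exact hf i j
  · intro h
    exact ⟨fun i j => X i j, h, rfl⟩

open Classical in
/-- `T(A)`: the number of ordered pairs `(X, Y)` of `2 × 2` matrices with entries in `A`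
that satisfy `XY = YX`. -/
noncomputable def commutingPairs (A : Finset ℝ) : ℕ :=
  ∑ X ∈ matricesWithEntries A, ∑ Y ∈ matricesWithEntries A, if X * Y = Y * X then 1 else 0

/-!
Two matrices `X`, `Y` of size `2 × 2` commute iff the vectors `(X₀₁, X₁₀, X₁₁ - X₀₀)` and
`(Y₀₁, Y₁₀, Y₁₁ - Y₀₀)` are parallel.

For the lower bound it is enough to count pairs for which these vectors are equal. There are
`#A ^ 2 * E(A)` of them, where `E(A)` is the additive energy, and `E(A) * #(A + A) ≥ #A ^ 4` by
Cauchy–Schwarz.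

For the upper bound, `#A ^ 4` pairs at most are diagonal, and by symmetry it remains to count the
pairs with `X₀₁ ≠ 0`. With the ratio `l = Y₀₁ / X₀₁` their number is `O(∑ l, r(l) ^ 2 * E(l))`,
where `r(l)` counts the points of `A × A` other than the origin on the line `y = l x`, and `E(l)`
counts the pairs of points of `A × A` that lie on a common line of slope `l`. Two facts control
this sum.

* `sum_card_slopePairs_le`: `∑ l ∈ L, E(l) = O(#A ^ 3 * √#L)`. Cut the grid into cells of about
  `√#L × √#L` points. A line meets `O(#A / √#L)` cells, so by Cauchy–Schwarz restricting to
  pairs in a common cell loses no more than this factor, and two distinct points determine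
  only one direction. This elementary form of the Szemerédi–Trotter theorem is available because the point set is a
  Cartesian product and the reals are ordered.
* `card_mul_sq_le_of_rich`: at most `O((#(A + A) / t) ^ 2)` slopes satisfy `r(l) ≥ t`, by
  Solymosi's sumset argument on consecutive rays.

Summing over the level sets `r(l) ≥ t` with weight `t` gives `O(#A ^ 4 * #(A + A))`, which is
`O(K * #A ^ 5)`.
-/

/-- The pairs `(p, q)` of points of the grid `A × A` such that `q - p` has direction `(1, l)`,
the pairs with `p = q` included. -/
noncomputable def slopePairs (A : Finset ℝ) (l : ℝ) : Finset ((ℝ × ℝ) × (ℝ × ℝ)) :=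
  ((A ×ˢ A) ×ˢ (A ×ˢ A)).filter fun z => z.2.2 - z.1.2 = l * (z.2.1 - z.1.1)

/-- The points of `A × A` on the open ray of slope `l` from the origin lying over the half-line of
those `x` that have the same sign as `σ`. -/
noncomputable def rayPoints (A : Finset ℝ) (σ l : ℝ) : Finset (ℝ × ℝ) :=
  (A ×ˢ A).filter fun p => 0 < σ * p.1 ∧ p.2 = l * p.1

/-- The points of `A × A` on the line of slope `l` through the origin. -/
noncomputable def linePoints (A : Finset ℝ) (l : ℝ) : Finset (ℝ × ℝ) :=
  (A ×ˢ A).filter fun p => p.2 = l * p.1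

/-- The slopes of the lines joining the origin to the points of `A × A`. The junk value `0` that
points with `x = 0` contribute is harmless. -/
noncomputable def slopes (A : Finset ℝ) : Finset ℝ :=
  (A ×ˢ A).image fun p => p.2 / p.1

theorem card_slopes_le (A : Finset ℝ) : (slopes A).card ≤ A.card ^ 2 := by
  refine Finset.card_image_le.trans ?_
  rw [Finset.card_product, sq]

/-! ### Pairs of grid points with a prescribed direction -/

/-- Cauchy–Schwarz: if each fibre of `v` is cut into at most `#J` parts by `g`, then passing to
pairs in the same part loses at most a factor `#J`. -/
theorem card_fiber_pairs_le {α β γ : Type*} [DecidableEq α] [DecidableEq β] [DecidableEq γ]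
    (P : Finset α) (v : α → β) (g : α → γ) (J : Finset γ) (hg : ∀ p ∈ P, g p ∈ J) :
    ((P ×ˢ P).filter fun z => v z.1 = v z.2).card ≤
      J.card * ((P ×ˢ P).filter fun z => v z.1 = v z.2 ∧ g z.1 = g z.2).card := by
  have h1 : ((P ×ˢ P).filter fun z => v z.1 = v z.2).card
      = ∑ b ∈ P.image v, (P.filter fun p => v p = b).card ^ 2 := by
    rw [Finset.card_eq_sum_card_fiberwise (f := fun z : α × α => v z.1) (t := P.image v)]
    · refine Finset.sum_congr rfl fun b _ => ?_
      rw [sq, ← Finset.card_product]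
      congr 1
      ext ⟨x, y⟩
      simp only [Finset.mem_filter, Finset.mem_product]
      grind
    · intro z hz
      simp only [Finset.coe_filter, Finset.mem_product, Set.mem_ofPred_eq] at hz
      exact Finset.mem_coe.2 (Finset.mem_image_of_mem v hz.1.1)
  have h2 : ((P ×ˢ P).filter fun z => v z.1 = v z.2 ∧ g z.1 = g z.2).card
      = ∑ b ∈ P.image v, ∑ c ∈ J, (P.filter fun p => v p = b ∧ g p = c).card ^ 2 := by
    rw [← Finset.sum_product',
      Finset.card_eq_sum_card_fiberwise (f := fun z : α × α => (v z.1, g z.1))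
        (t := P.image v ×ˢ J)]
    · refine Finset.sum_congr rfl fun b _ => ?_
      rw [sq, ← Finset.card_product]
      congr 1
      ext ⟨x, y⟩
      obtain ⟨b, c⟩ := b
      simp only [Finset.mem_filter, Finset.mem_product, Prod.mk.injEq]
      grind
    · intro z hz
      simp only [Finset.coe_filter, Finset.mem_product, Set.mem_ofPred_eq] at hz
      exact Finset.mem_coe.2 (Finset.mem_product.2
        ⟨Finset.mem_image_of_mem v hz.1.1, hg _ hz.1.1⟩)
  rw [h1, h2, Finset.mul_sum]
  refine Finset.sum_le_sum fun b _ => ?_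
  have h3 : (P.filter fun p => v p = b).card
      = ∑ c ∈ J, (P.filter fun p => v p = b ∧ g p = c).card := by
    rw [Finset.card_eq_sum_card_fiberwise (f := g) (t := J)]
    · simp only [Finset.filter_filter]
    · intro p hp
      exact hg p (Finset.mem_filter.1 hp).1
  rw [h3]
  exact sq_sum_le_card_mul_sum_sq

/-- A line meets few cells of a grid of `(k + 1) ^ 2` cells, at most `2 * k + 1`, because the cells
met by a line form a chain. -/
theorem card_slopePairs_le (A : Finset ℝ) (f : ℝ → ℕ) (hf : Monotone f) (k : ℕ)
    (hk : ∀ a ∈ A, f a ≤ k) (l : ℝ) :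
    (slopePairs A l).card ≤ (2 * k + 1) *
      ((slopePairs A l).filter fun z => f z.1.1 = f z.2.1 ∧ f z.1.2 = f z.2.2).card := by
  classical
  have key : ∀ (g : ℝ × ℝ → ℤ) (J : Finset ℤ), J.card = 2 * k + 1 →
      (∀ p ∈ A ×ˢ A, g p ∈ J) →
      (∀ p q : ℝ × ℝ, q.2 - p.2 = l * (q.1 - p.1) → g p = g q → f p.1 = f q.1 ∧ f p.2 = f q.2) →
      (slopePairs A l).card ≤ (2 * k + 1) *
        ((slopePairs A l).filter fun z => f z.1.1 = f z.2.1 ∧ f z.1.2 = f z.2.2).card := by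
    intro g J hJ hg hinj
    have h := card_fiber_pairs_le (A ×ˢ A) (fun p => p.2 - l * p.1) g J hg
    rw [hJ] at h
    have e1 : (((A ×ˢ A) ×ˢ (A ×ˢ A)).filter fun z : (ℝ × ℝ) × (ℝ × ℝ) =>
        z.1.2 - l * z.1.1 = z.2.2 - l * z.2.1) = slopePairs A l := by
      refine Finset.filter_congr fun z _ => ?_
      constructor <;> intro h <;> linarith
    rw [e1] at h
    refine h.trans (Nat.mul_le_mul_left _ (Finset.card_le_card ?_))
    intro z hz
    simp only [slopePairs, Finset.mem_filter] at hz ⊢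
    have hz1 : z.2.2 - z.1.2 = l * (z.2.1 - z.1.1) := by linarith [hz.2.1]
    exact ⟨⟨hz.1, hz1⟩, hinj _ _ hz1 hz.2.2⟩
  rcases le_or_gt 0 l with hl | hl
  · refine key (fun p => (f p.1 : ℤ) + f p.2) (Finset.Icc 0 (2 * k)) (by simp; omega) ?_ ?_
    · intro p hp
      have h1 := hk _ (Finset.mem_product.1 hp).1
      have h2 := hk _ (Finset.mem_product.1 hp).2
      rw [Finset.mem_Icc]
      omega
    · intro p q hpq hg
      rcases le_total p.1 q.1 with h | h
      · have h1 := hf h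
        have h2 : f p.2 ≤ f q.2 := hf (by nlinarith [mul_nonneg hl (sub_nonneg.2 h)])
        omega
      · have h1 := hf h
        have h2 : f q.2 ≤ f p.2 := hf (by nlinarith [mul_nonneg hl (sub_nonneg.2 h)])
        omega
  · refine key (fun p => (f p.1 : ℤ) - f p.2) (Finset.Icc (-k) k) (by simp; omega) ?_ ?_
    · intro p hp
      have h1 := hk _ (Finset.mem_product.1 hp).1
      have h2 := hk _ (Finset.mem_product.1 hp).2
      rw [Finset.mem_Icc]
      omega
    · intro p q hpq hg
      rcases le_total p.1 q.1 with h | h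
      · have h1 := hf h
        have h2 : f q.2 ≤ f p.2 := hf (by nlinarith [mul_nonneg (neg_pos.2 hl).le (sub_nonneg.2 h)])
        omega
      · have h1 := hf h
        have h2 : f p.2 ≤ f q.2 := hf (by nlinarith [mul_nonneg (neg_pos.2 hl).le (sub_nonneg.2 h)])
        omega

/-- A finite set of reals can be cut into consecutive blocks of at most `m` elements. -/
theorem exists_monotone_blocks (A : Finset ℝ) (m : ℕ) (hm : 0 < m) :
    ∃ f : ℝ → ℕ, Monotone f ∧ (∀ a ∈ A, f a ≤ A.card / m) ∧
      ∀ j, (A.filter fun a => j = f a).card ≤ m := by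
  have hmono : Monotone fun a => (A.filter fun x => x < a).card := fun a b hab =>
    Finset.card_le_card fun x hx => by
      simp only [Finset.mem_filter] at hx ⊢
      exact ⟨hx.1, hx.2.trans_le hab⟩
  have hstrict : ∀ a ∈ A, ∀ b, a < b →
      (A.filter fun x => x < a).card < (A.filter fun x => x < b).card := by
    intro a ha b hab
    refine Finset.card_lt_card ⟨fun x hx => ?_, fun h => ?_⟩
    · simp only [Finset.mem_filter] at hx ⊢
      exact ⟨hx.1, hx.2.trans hab⟩
    · have := h (Finset.mem_filter.2 ⟨ha, hab⟩)
      simp at this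
  refine ⟨fun a => (A.filter fun x => x < a).card / m,
    fun a b hab => Nat.div_le_div_right (hmono hab),
    fun a _ => Nat.div_le_div_right (Finset.card_filter_le _ _), fun j => ?_⟩
  calc _ ≤ (Finset.Ico (j * m) (j * m + m)).card := by
        refine Finset.card_le_card_of_injOn (fun a => (A.filter fun x => x < a).card) ?_ ?_
        · intro a ha
          have h : j = (A.filter fun x => x < a).card / m := (Finset.mem_filter.1 ha).2
          have h1 := Nat.div_add_mod (A.filter fun x => x < a).card m
          have h2 := Nat.mod_lt (A.filter fun x => x < a).card hm
          rw [← h, mul_comm] at h1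
          simp only [Finset.coe_Ico, Set.mem_Ico]
          omega
        · intro a ha b hb hab
          simp only at hab
          rcases lt_trichotomy a b with h | h | h
          · have := hstrict a (Finset.mem_filter.1 ha).1 b h
            omega
          · exact h
          · have := hstrict b (Finset.mem_filter.1 hb).1 a h
            omega
    _ = m := by simp

/-- The grid is cut into cells of at most `m × m` points. The first factor bounds the number of
cells that a line meets, `#A ^ 2 * m ^ 2` bounds the pairs of distinct points in a common cell, and
`#A ^ 2 * #L` counts the pairs of equal points. -/
theorem sum_card_slopePairs_le_of_blocks (A L : Finset ℝ) (m : ℕ) (hm : 0 < m) :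
    ∑ l ∈ L, (slopePairs A l).card ≤
      (2 * (A.card / m) + 1) * (A.card ^ 2 * (m ^ 2 + L.card)) := by
  classical
  obtain ⟨f, hf, hk, hfib⟩ := exists_monotone_blocks A m hm
  let c : (ℝ × ℝ) × (ℝ × ℝ) → Prop := fun z => f z.1.1 = f z.2.1 ∧ f z.1.2 = f z.2.2
  refine (Finset.sum_le_sum fun l _ => card_slopePairs_le A f hf _ hk l).trans ?_
  rw [← Finset.mul_sum]
  refine Nat.mul_le_mul_left _ ?_
  have hsplit : ∀ l, ((slopePairs A l).filter c).card ≤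
      A.card ^ 2 + (((slopePairs A l).filter c).filter fun z => z.1 ≠ z.2).card := by
    intro l
    rw [← Finset.card_filter_add_card_filter_not (s := (slopePairs A l).filter c)
      (fun z => z.1 = z.2)]
    refine Nat.add_le_add_right ?_ _
    rw [sq, ← Finset.card_product]
    refine Finset.card_le_card_of_injOn Prod.fst ?_ ?_
    · intro z hz
      simp only [slopePairs, Finset.coe_filter, Finset.mem_filter, Set.mem_ofPred_eq,
        Finset.mem_product] at hz
      simp only [Finset.mem_coe, Finset.mem_product]
      exact hz.1.1.1.1
    · intro z hz w hw h
      exact Prod.ext h ((Finset.mem_filter.1 hz).2.symm.trans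
        (h.trans (Finset.mem_filter.1 hw).2))
  have hcell : (((A ×ˢ A) ×ˢ (A ×ˢ A)).filter c).card ≤ A.card ^ 2 * m ^ 2 := by
    rw [Finset.card_filter, Finset.sum_product]
    have : ∀ p ∈ A ×ˢ A, (∑ q ∈ A ×ˢ A, if c (p, q) then 1 else 0) ≤ m ^ 2 := by
      intro p _
      rw [← Finset.card_filter]
      have e : ((A ×ˢ A).filter fun q => c (p, q)) =
          (A.filter fun a => f p.1 = f a) ×ˢ (A.filter fun a => f p.2 = f a) := by
        rw [← Finset.filter_product]
      rw [e, Finset.card_product, sq]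
      exact Nat.mul_le_mul (hfib _) (hfib _)
    refine (Finset.sum_le_card_nsmul _ _ _ this).trans ?_
    rw [Finset.card_product, smul_eq_mul, sq A.card]
  -- Two distinct points determine at most one direction.
  have hdisj : ∑ l ∈ L, (((slopePairs A l).filter c).filter fun z => z.1 ≠ z.2).card ≤
      (((A ×ˢ A) ×ˢ (A ×ˢ A)).filter c).card := by
    rw [← Finset.card_biUnion]
    · refine Finset.card_le_card fun z hz => ?_
      simp only [slopePairs, Finset.mem_biUnion, Finset.mem_filter] at hz ⊢
      obtain ⟨l, _, hz⟩ := hz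
      exact ⟨hz.1.1.1, hz.1.2⟩
    · intro l _ l' _ hll
      rw [Function.onFun, Finset.disjoint_left]
      intro z hz hz'
      simp only [slopePairs, Finset.mem_filter] at hz hz'
      have h1 := hz.1.1.2
      have h2 := hz'.1.1.2
      have h3 : (l - l') * (z.2.1 - z.1.1) = 0 := by linarith
      rcases mul_eq_zero.1 h3 with h | h
      · exact hll (sub_eq_zero.1 h)
      · rw [h, mul_zero] at h1
        exact hz.2 (Prod.ext (sub_eq_zero.1 h).symm (sub_eq_zero.1 h1).symm)
  calc ∑ l ∈ L, ((slopePairs A l).filter c).card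
      ≤ ∑ l ∈ L, (A.card ^ 2 +
          (((slopePairs A l).filter c).filter fun z => z.1 ≠ z.2).card) :=
        Finset.sum_le_sum fun l _ => hsplit l
    _ ≤ L.card * A.card ^ 2 + A.card ^ 2 * m ^ 2 := by
        rw [Finset.sum_add_distrib, Finset.sum_const, smul_eq_mul]
        exact Nat.add_le_add_left (hdisj.trans hcell) _
    _ = A.card ^ 2 * (m ^ 2 + L.card) := by ring

/-- The Szemerédi–Trotter type saving: for few directions the trivial bound `#L * #A ^ 3` improves
to `√#L * #A ^ 3`. -/
theorem sum_card_slopePairs_le (A L : Finset ℝ) (hL : L.card ≤ A.card ^ 2) :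
    ((∑ l ∈ L, (slopePairs A l).card : ℕ) : ℝ) ≤ 16 * (A.card : ℝ) ^ 3 * √(L.card : ℝ) := by
  rcases Nat.eq_zero_or_pos L.card with h0 | hpos
  · rw [Finset.card_eq_zero] at h0
    simp [h0]
  -- Blocks of about `√#L` elements balance the two terms of the cell bound.
  set s := Nat.sqrt L.card with hs
  have hs1 : 1 ≤ s := Nat.sqrt_pos.2 hpos
  have hsn : s ≤ A.card := by
    simpa only [Nat.sqrt_eq'] using Nat.sqrt_le_sqrt hL
  have hlt : L.card ≤ (s + 1) ^ 2 := (Nat.lt_succ_sqrt' _).le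
  have hsq : (s : ℝ) ≤ √(L.card : ℝ) := by
    rw [hs]
    exact Real.nat_sqrt_le_real_sqrt
  have hdiv : (2 * (A.card / (s + 1)) + 1) * (s + 1) ≤ 4 * A.card := by
    have := Nat.div_mul_le_self A.card (s + 1)
    nlinarith
  have hmain := sum_card_slopePairs_le_of_blocks A L (s + 1) (Nat.succ_pos _)
  have hnat : ∑ l ∈ L, (slopePairs A l).card ≤ 16 * A.card ^ 3 * s := by
    calc _ ≤ (2 * (A.card / (s + 1)) + 1) * (A.card ^ 2 * (2 * (s + 1) ^ 2)) :=
          hmain.trans (by gcongr; omega)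
      _ = ((2 * (A.card / (s + 1)) + 1) * (s + 1)) * (2 * A.card ^ 2 * (s + 1)) := by ring
      _ ≤ (4 * A.card) * (2 * A.card ^ 2 * (s + s)) := by gcongr
      _ = 16 * A.card ^ 3 * s := by ring
  calc _ ≤ ((16 * A.card ^ 3 * s : ℕ) : ℝ) := by exact_mod_cast hnat
    _ = 16 * (A.card : ℝ) ^ 3 * s := by push_cast; ring
    _ ≤ _ := by gcongr

/-! ### Rich lines through the origin -/

/-- Solymosi's argument: sums of points on consecutive rays are distinct and lie strictly between
the two rays, so each pair of consecutive rays contributes `t ^ 2` new points of the sumset of the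
grid. -/
theorem card_mul_sq_le_card_sector (A : Finset ℝ) (σ : ℝ) (t : ℕ) (L : Finset ℝ) :
    ∀ μ, (∀ l ∈ L, l < μ) → (∀ l ∈ L, t ≤ (rayPoints A σ l).card) →
      t ≤ (rayPoints A σ μ).card →
      L.card * t ^ 2 ≤
        (((A + A) ×ˢ (A + A)).filter fun z =>
          0 < σ * z.1 ∧ σ * z.2 < μ * (σ * z.1)).card := by
  classical
  induction L using Finset.induction_on_max with
  | empty => intro μ _ _ _; simp
  | insert ν L hν ih =>
    intro μ hμ hL hμt
    have hνμ : ν < μ := hμ ν (Finset.mem_insert_self _ _)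
    have hνt := hL ν (Finset.mem_insert_self _ _)
    have h1 := ih ν hν (fun l hl => hL l (Finset.mem_insert_of_mem hl)) hνt
    have hnot : ν ∉ L := fun h => lt_irrefl _ (hν ν h)
    have h2 : t ^ 2 ≤ ((rayPoints A σ ν ×ˢ rayPoints A σ μ).image fun w => w.1 + w.2).card := by
      rw [Finset.card_image_of_injOn, Finset.card_product, sq]
      · exact Nat.mul_le_mul hνt hμt
      · rintro ⟨p, q⟩ hw ⟨p', q'⟩ hw' h
        simp only [rayPoints, Finset.coe_product, Finset.coe_filter, Set.mem_prod,
          Set.mem_ofPred_eq] at hw hw'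
        have e1 : p.1 + q.1 = p'.1 + q'.1 := congrArg Prod.fst h
        have e2 : p.2 + q.2 = p'.2 + q'.2 := congrArg Prod.snd h
        rw [hw.1.2.2, hw.2.2.2, hw'.1.2.2, hw'.2.2.2] at e2
        have e3 : (μ - ν) * (q.1 - q'.1) = 0 := by linear_combination e2 - ν * e1
        have e4 : q.1 = q'.1 := by
          rcases mul_eq_zero.1 e3 with h | h <;> linarith
        have e5 : p.1 = p'.1 := by linarith
        refine Prod.ext (Prod.ext e5 ?_) (Prod.ext e4 ?_)
        · rw [hw.1.2.2, hw'.1.2.2, e5]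
        · rw [hw.2.2.2, hw'.2.2.2, e4]
    have hmem : ∀ z ∈ (rayPoints A σ ν ×ˢ rayPoints A σ μ).image (fun w => w.1 + w.2),
        z ∈ (A + A) ×ˢ (A + A) ∧ ν * (σ * z.1) < σ * z.2 ∧ σ * z.2 < μ * (σ * z.1) ∧
          0 < σ * z.1 := by
      intro z hz
      obtain ⟨⟨p, q⟩, hw, rfl⟩ := Finset.mem_image.1 hz
      simp only [rayPoints, Finset.mem_product, Finset.mem_filter] at hw
      obtain ⟨⟨hpA, hp, hp2⟩, hqA, hq, hq2⟩ := hw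
      have k1 := mul_pos (sub_pos.2 hνμ) hp
      have k2 := mul_pos (sub_pos.2 hνμ) hq
      refine ⟨Finset.mem_product.2 ⟨Finset.add_mem_add hpA.1 hqA.1,
        Finset.add_mem_add hpA.2 hqA.2⟩, ?_, ?_, ?_⟩
      · simp only [Prod.fst_add, Prod.snd_add, hp2, hq2]
        nlinarith
      · simp only [Prod.fst_add, Prod.snd_add, hp2, hq2]
        nlinarith
      · simp only [Prod.fst_add, mul_add]
        exact add_pos hp hq
    rw [Finset.card_insert_of_notMem hnot, add_mul, one_mul]
    refine (Nat.add_le_add h1 h2).trans ?_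
    rw [← Finset.card_union_of_disjoint]
    · refine Finset.card_le_card fun z hz => ?_
      rw [Finset.mem_filter]
      rcases Finset.mem_union.1 hz with hz | hz
      · obtain ⟨hzA, hz1, hz2⟩ := Finset.mem_filter.1 hz
        exact ⟨hzA, hz1, hz2.trans (mul_lt_mul_of_pos_right hνμ hz1)⟩
      · obtain ⟨hzA, _, hz2, hz1⟩ := hmem z hz
        exact ⟨hzA, hz1, hz2⟩
    · rw [Finset.disjoint_left]
      intro z hz hz'
      exact lt_asymm (Finset.mem_filter.1 hz).2.2 (hmem z hz').2.1

theorem card_rayPoints_le (A : Finset ℝ) (σ l : ℝ) : (rayPoints A σ l).card ≤ A.card := by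
  refine Finset.card_le_card_of_injOn Prod.fst ?_ ?_
  · intro p hp
    exact (Finset.mem_product.1 (Finset.mem_filter.1 hp).1).1
  · intro p hp q hq h
    refine Prod.ext h ?_
    rw [(Finset.mem_filter.1 hp).2.2, (Finset.mem_filter.1 hq).2.2, h]

theorem card_mul_sq_le_of_rich (A L : Finset ℝ) (σ : ℝ) (t : ℕ)
    (hL : ∀ l ∈ L, t ≤ (rayPoints A σ l).card) :
    L.card * t ^ 2 ≤ 2 * (A + A).card ^ 2 := by
  rcases L.eq_empty_or_nonempty with rfl | hne
  · simp
  have hμ := L.max'_mem hne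
  have h1 := card_mul_sq_le_card_sector A σ t (L.erase (L.max' hne)) (L.max' hne)
    (fun l hl => L.lt_max'_of_mem_erase_max' hne hl)
    (fun l hl => hL l (Finset.mem_of_mem_erase hl)) (hL _ hμ)
  have h2 := h1.trans (Finset.card_filter_le _ _)
  rw [Finset.card_product, ← sq] at h2
  have h3 : t ≤ (A + A).card :=
    (hL _ hμ).trans ((card_rayPoints_le A σ _).trans Finset.card_le_card_add_self)
  have h4 := Nat.pow_le_pow_left h3 2
  rw [← Finset.card_erase_add_one hμ]
  linarith

/-! ### The weighted moment -/

theorem sq_le_sum_Icc_ite {r n : ℕ} (h : r ≤ n) :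
    r ^ 2 ≤ ∑ t ∈ Finset.Icc 1 n, if t ≤ r then 2 * t else 0 := by
  induction r with
  | zero => simp
  | succ r ih =>
    have h1 := ih (by omega)
    have h2 : ∑ t ∈ Finset.Icc 1 n, (if t = r + 1 then 2 * t else 0) = 2 * (r + 1) := by
      rw [Finset.sum_ite_eq', if_pos (Finset.mem_Icc.2 ⟨by omega, h⟩)]
    have h3 : ∑ t ∈ Finset.Icc 1 n, (if t ≤ r + 1 then 2 * t else 0) =
        (∑ t ∈ Finset.Icc 1 n, if t ≤ r then 2 * t else 0) +
          ∑ t ∈ Finset.Icc 1 n, (if t = r + 1 then 2 * t else 0) := by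
      rw [← Finset.sum_add_distrib]
      refine Finset.sum_congr rfl fun t _ => ?_
      split_ifs <;> omega
    rw [h3, h2]
    nlinarith

/-- There are `O((#(A + A) / t) ^ 2)` slopes of richness at least `t`, and these carry
`O(#A ^ 3 * #(A + A) / t)` pairs. After weighting by `t`, every `t ≤ #A` contributes equally, so
that no logarithm is lost. -/
theorem sum_sq_card_rayPoints_mul_le (A : Finset ℝ) (σ : ℝ) :
    ((∑ l ∈ slopes A, (rayPoints A σ l).card ^ 2 * (slopePairs A l).card : ℕ) : ℝ) ≤
      64 * (A.card : ℝ) ^ 4 * ((A + A).card : ℝ) := by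
  classical
  have hlayer : ∑ l ∈ slopes A, (rayPoints A σ l).card ^ 2 * (slopePairs A l).card ≤
      ∑ t ∈ Finset.Icc 1 A.card, 2 * t *
        ∑ l ∈ (slopes A).filter (fun l => t ≤ (rayPoints A σ l).card),
          (slopePairs A l).card := by
    calc _ ≤ ∑ l ∈ slopes A, ∑ t ∈ Finset.Icc 1 A.card,
          (if t ≤ (rayPoints A σ l).card then 2 * t else 0) * (slopePairs A l).card := by
          refine Finset.sum_le_sum fun l _ => ?_
          rw [← Finset.sum_mul]
          exact Nat.mul_le_mul_right _ (sq_le_sum_Icc_ite (card_rayPoints_le A σ l))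
      _ = _ := by
          rw [Finset.sum_comm]
          refine Finset.sum_congr rfl fun t _ => ?_
          rw [Finset.mul_sum, Finset.sum_filter]
          refine Finset.sum_congr rfl fun l _ => ?_
          split_ifs <;> simp
  have hterm : ∀ t ∈ Finset.Icc 1 A.card, ((2 * t *
        ∑ l ∈ (slopes A).filter (fun l => t ≤ (rayPoints A σ l).card),
          (slopePairs A l).card : ℕ) : ℝ) ≤ 64 * (A.card : ℝ) ^ 3 * ((A + A).card : ℝ) := by
    intro t _
    set L := (slopes A).filter (fun l => t ≤ (rayPoints A σ l).card) with hLdef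
    have h1 := sum_card_slopePairs_le A L
      ((Finset.card_filter_le _ _).trans (card_slopes_le A))
    have h2 := card_mul_sq_le_of_rich A L σ t fun l hl => (Finset.mem_filter.1 hl).2
    have h3 : (t : ℝ) * √(L.card : ℝ) ≤ 2 * ((A + A).card : ℝ) := by
      have h2' : (L.card : ℝ) * (t : ℝ) ^ 2 ≤ 2 * ((A + A).card : ℝ) ^ 2 := by exact_mod_cast h2
      refine abs_le_of_sq_le_sq' ?_ (by positivity) |>.2
      rw [mul_pow, Real.sq_sqrt (Nat.cast_nonneg _)]
      nlinarith [sq_nonneg ((A + A).card : ℝ)]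
    rw [Nat.cast_mul, Nat.cast_mul, Nat.cast_ofNat]
    calc (2 : ℝ) * t * ((∑ l ∈ L, (slopePairs A l).card : ℕ) : ℝ)
        ≤ 2 * t * (16 * (A.card : ℝ) ^ 3 * √(L.card : ℝ)) := by gcongr
      _ = 32 * (A.card : ℝ) ^ 3 * (t * √(L.card : ℝ)) := by ring
      _ ≤ 32 * (A.card : ℝ) ^ 3 * (2 * ((A + A).card : ℝ)) := by gcongr
      _ = _ := by ring
  calc _ ≤ ((∑ t ∈ Finset.Icc 1 A.card, 2 * t *
        ∑ l ∈ (slopes A).filter (fun l => t ≤ (rayPoints A σ l).card),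
          (slopePairs A l).card : ℕ) : ℝ) := by exact_mod_cast hlayer
    _ ≤ ∑ t ∈ Finset.Icc 1 A.card, 64 * (A.card : ℝ) ^ 3 * ((A + A).card : ℝ) := by
        rw [Nat.cast_sum]
        exact Finset.sum_le_sum hterm
    _ = _ := by
        rw [Finset.sum_const, Nat.card_Icc, nsmul_eq_mul, Nat.add_sub_cancel]
        ring

theorem card_linePoints_le (A : Finset ℝ) (l : ℝ) :
    (linePoints A l).card ≤ (rayPoints A 1 l).card + (rayPoints A (-1) l).card + 1 := by
  classical
  have h : linePoints A l ⊆ (rayPoints A 1 l ∪ rayPoints A (-1) l) ∪ {(0, 0)} := by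
    intro p hp
    obtain ⟨hpA, hp⟩ := Finset.mem_filter.1 hp
    simp only [rayPoints, Finset.mem_union, Finset.mem_filter, Finset.mem_singleton]
    rcases lt_trichotomy p.1 0 with h | h | h
    · exact Or.inl (Or.inr ⟨hpA, by linarith, hp⟩)
    · exact Or.inr (Prod.ext h (by rw [hp, h, mul_zero]))
    · exact Or.inl (Or.inl ⟨hpA, by linarith, hp⟩)
  refine (Finset.card_le_card h).trans ((Finset.card_union_le _ _).trans ?_)
  rw [Finset.card_singleton]
  exact Nat.add_le_add_right (Finset.card_union_le _ _) _

theorem sum_card_rayPoints_mul_le (A : Finset ℝ) :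
    ((∑ l ∈ slopes A, ((rayPoints A 1 l).card + (rayPoints A (-1) l).card) *
        ((linePoints A l).card * (slopePairs A l).card) : ℕ) : ℝ) ≤
      512 * (A.card : ℝ) ^ 4 * ((A + A).card : ℝ) := by
  have hnat : ∑ l ∈ slopes A, ((rayPoints A 1 l).card + (rayPoints A (-1) l).card) *
        ((linePoints A l).card * (slopePairs A l).card) ≤
      4 * ∑ l ∈ slopes A, (rayPoints A 1 l).card ^ 2 * (slopePairs A l).card +
      4 * ∑ l ∈ slopes A, (rayPoints A (-1) l).card ^ 2 * (slopePairs A l).card := by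
    rw [← mul_add, ← Finset.sum_add_distrib, Finset.mul_sum]
    refine Finset.sum_le_sum fun l _ => ?_
    rw [← mul_assoc, ← add_mul, ← mul_assoc]
    refine Nat.mul_le_mul_right _ ?_
    have h := card_linePoints_le A l
    generalize (rayPoints A 1 l).card = x at *
    generalize (rayPoints A (-1) l).card = y at *
    -- The origin on the line is absorbed because the product vanishes when both rays are empty.
    rcases Nat.eq_zero_or_pos (x + y) with h0 | h0
    · rw [h0, zero_mul]
      exact Nat.zero_le _
    · calc (x + y) * (linePoints A l).card ≤ (x + y) * (2 * (x + y)) :=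
            Nat.mul_le_mul_left _ (by omega)
        _ ≤ 4 * (x ^ 2 + y ^ 2) := by
            zify
            nlinarith [sq_nonneg ((x : ℤ) - y)]
  have h1 := sum_sq_card_rayPoints_mul_le A 1
  have h2 := sum_sq_card_rayPoints_mul_le A (-1)
  have h3 : ((_ : ℕ) : ℝ) ≤ ((_ : ℕ) : ℝ) := Nat.cast_le.2 hnat
  rw [Nat.cast_add, Nat.cast_mul, Nat.cast_mul, Nat.cast_ofNat] at h3
  linarith

/-! ### Commuting pairs -/

/-- The ordered pairs of commuting `2 × 2` matrices with entries in `A`. -/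
noncomputable def commutingFinset (A : Finset ℝ) :
    Finset (Matrix (Fin 2) (Fin 2) ℝ × Matrix (Fin 2) (Fin 2) ℝ) :=
  open Classical in
  (matricesWithEntries A ×ˢ matricesWithEntries A).filter fun w => w.1 * w.2 = w.2 * w.1

theorem mem_commutingFinset {A : Finset ℝ}
    {w : Matrix (Fin 2) (Fin 2) ℝ × Matrix (Fin 2) (Fin 2) ℝ} :
    w ∈ commutingFinset A ↔
      ((∀ i j, w.1 i j ∈ A) ∧ ∀ i j, w.2 i j ∈ A) ∧ w.1 * w.2 = w.2 * w.1 := by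
  simp only [commutingFinset, Finset.mem_filter, Finset.mem_product, mem_matricesWithEntries]

theorem card_commutingFinset (A : Finset ℝ) : (commutingFinset A).card = commutingPairs A := by
  classical
  rw [commutingFinset, commutingPairs, Finset.card_filter, Finset.sum_product]

theorem mul_comm_fin_two_iff {X Y : Matrix (Fin 2) (Fin 2) ℝ} {i j : Fin 2} (hij : i ≠ j) :
    X * Y = Y * X ↔ X i j * Y j i = X j i * Y i j ∧
      (Y j j - Y i i) * X i j = (X j j - X i i) * Y i j ∧
      (Y j j - Y i i) * X j i = (X j j - X i i) * Y j i := by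
  rw [← Matrix.ext_iff]
  simp only [Fin.forall_fin_two, Matrix.mul_apply, Fin.sum_univ_two]
  fin_cases i <;> fin_cases j
  · exact absurd rfl hij
  · simp only [Fin.zero_eta, Fin.mk_one, Fin.isValue]
    constructor
    · rintro ⟨⟨h1, h2⟩, h3, h4⟩
      exact ⟨by linarith, by linarith, by linarith⟩
    · rintro ⟨h1, h2, h3⟩
      exact ⟨⟨by linarith, by linarith⟩, by linarith, by linarith⟩
  · simp only [Fin.zero_eta, Fin.mk_one, Fin.isValue]
    constructor
    · rintro ⟨⟨h1, h2⟩, h3, h4⟩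
      exact ⟨by linarith, by linarith, by linarith⟩
    · rintro ⟨h1, h2, h3⟩
      exact ⟨⟨by linarith, by linarith⟩, by linarith, by linarith⟩
  · exact absurd rfl hij

/-- Two matrices are determined by their entries, listed with the positions `(i, j)` and `(j, i)`
first and the diagonal ones after them. -/
theorem entries_injective {i j : Fin 2} (hij : i ≠ j) :
    Function.Injective fun w : Matrix (Fin 2) (Fin 2) ℝ × Matrix (Fin 2) (Fin 2) ℝ =>
      ((w.1 i j, w.2 i j), (w.1 j i, w.2 j i), (w.1 i i, w.2 i i), (w.1 j j, w.2 j j)) := by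
  rintro ⟨X, Y⟩ ⟨X', Y'⟩ h
  simp only [Prod.mk.injEq] at h
  obtain ⟨⟨h1, h2⟩, ⟨h3, h4⟩, ⟨h5, h6⟩, h7, h8⟩ := h
  have hcov : ∀ k : Fin 2, k = i ∨ k = j := by omega
  refine Prod.ext ?_ ?_ <;>
  · ext a b
    rcases hcov a with rfl | rfl <;> rcases hcov b with rfl | rfl <;> assumption

/-- If `X i j ≠ 0`, then the ratio `l = Y i j / X i j` is also the ratio of the other two
coordinates of the parallel vectors attached to `Y` and `X`. -/
theorem card_commuting_fst_ne_zero_le (A : Finset ℝ) {i j : Fin 2} (hij : i ≠ j) :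
    ((commutingFinset A).filter fun w => w.1 i j ≠ 0).card ≤
      ∑ l ∈ slopes A, ((rayPoints A 1 l).card + (rayPoints A (-1) l).card) *
        ((linePoints A l).card * (slopePairs A l).card) := by
  classical
  calc _ ≤ ((slopes A).biUnion fun l => (rayPoints A 1 l ∪ rayPoints A (-1) l) ×ˢ
        (linePoints A l ×ˢ slopePairs A l)).card := by
        refine Finset.card_le_card_of_injOn _ ?_ (entries_injective hij).injOn
        rintro ⟨X, Y⟩ hw
        obtain ⟨hw, hne⟩ := Finset.mem_filter.1 hw
        obtain ⟨⟨hX, hY⟩, hXY⟩ := mem_commutingFinset.1 hw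
        simp only at hne hX hY hXY
        obtain ⟨h1, h2, -⟩ := (mul_comm_fin_two_iff hij).1 hXY
        have e1 : Y i j = Y i j / X i j * X i j := by field_simp
        have e2 : Y j i = Y i j / X i j * X j i := by
          field_simp
          linarith
        have e3 : Y j j - Y i i = Y i j / X i j * (X j j - X i i) := by
          field_simp
          linarith
        simp only [Finset.mem_coe, Finset.mem_biUnion, Finset.mem_product, Finset.mem_union,
          rayPoints, linePoints, slopePairs, Finset.mem_filter]
        refine ⟨Y i j / X i j, Finset.mem_image.2 ⟨(X i j, Y i j),
          Finset.mem_product.2 ⟨hX _ _, hY _ _⟩, rfl⟩, ?_, ⟨⟨hX _ _, hY _ _⟩, e2⟩,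
          ⟨⟨hX _ _, hY _ _⟩, hX _ _, hY _ _⟩, e3⟩
        rcases lt_or_gt_of_ne hne with h | h
        · exact Or.inr ⟨⟨hX _ _, hY _ _⟩, by linarith, e1⟩
        · exact Or.inl ⟨⟨hX _ _, hY _ _⟩, by linarith, e1⟩
    _ ≤ _ := by
        refine Finset.card_biUnion_le.trans (Finset.sum_le_sum fun l _ => ?_)
        rw [Finset.card_product, Finset.card_product]
        exact Nat.mul_le_mul_right _ (Finset.card_union_le _ _)

theorem card_commuting_snd_ne_zero_le (A : Finset ℝ) (i j : Fin 2) :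
    ((commutingFinset A).filter fun w => w.2 i j ≠ 0).card ≤
      ((commutingFinset A).filter fun w => w.1 i j ≠ 0).card := by
  refine Finset.card_le_card_of_injOn Prod.swap ?_ Prod.swap_injective.injOn
  intro w hw
  obtain ⟨hw, hne⟩ := Finset.mem_filter.1 hw
  obtain ⟨⟨hX, hY⟩, hXY⟩ := mem_commutingFinset.1 hw
  exact Finset.mem_filter.2 ⟨mem_commutingFinset.2 ⟨⟨hY, hX⟩, hXY.symm⟩, hne⟩

theorem card_commuting_diagonal_le (A : Finset ℝ) :
    ((commutingFinset A).filter fun w =>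
      (w.1 0 1 = 0 ∧ w.1 1 0 = 0) ∧ w.2 0 1 = 0 ∧ w.2 1 0 = 0).card ≤ A.card ^ 4 := by
  calc _ ≤ (({(0, 0)} : Finset (ℝ × ℝ)) ×ˢ (({(0, 0)} : Finset (ℝ × ℝ)) ×ˢ
        ((A ×ˢ A) ×ˢ (A ×ˢ A)))).card := by
        refine Finset.card_le_card_of_injOn _ ?_
          (entries_injective (i := 0) (j := 1) (by decide)).injOn
        intro w hw
        obtain ⟨hw, ⟨h1, h2⟩, h3, h4⟩ := Finset.mem_filter.1 hw
        obtain ⟨⟨hX, hY⟩, -⟩ := mem_commutingFinset.1 hw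
        simp only [Finset.mem_coe, Finset.mem_product, Finset.mem_singleton, h1, h2, h3, h4,
          hX, hY, and_self]
    _ = A.card ^ 4 := by
        simp only [Finset.card_product, Finset.card_singleton]
        ring

theorem commutingPairs_le (A : Finset ℝ) (hA : A.Nonempty) :
    (commutingPairs A : ℝ) ≤ 2049 * (A.card : ℝ) ^ 4 * ((A + A).card : ℝ) := by
  classical
  set M := ∑ l ∈ slopes A, ((rayPoints A 1 l).card + (rayPoints A (-1) l).card) *
        ((linePoints A l).card * (slopePairs A l).card) with hM
  have hM' : (M : ℝ) ≤ 512 * (A.card : ℝ) ^ 4 * ((A + A).card : ℝ) :=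
    sum_card_rayPoints_mul_le A
  have h01 := card_commuting_fst_ne_zero_le A (i := 0) (j := 1) (by decide)
  have h10 := card_commuting_fst_ne_zero_le A (i := 1) (j := 0) (by decide)
  have hs01 := card_commuting_snd_ne_zero_le A 0 1
  have hs10 := card_commuting_snd_ne_zero_le A 1 0
  have hd := card_commuting_diagonal_le A
  rw [← hM] at h01 h10
  have hcover : commutingFinset A ⊆
      (((commutingFinset A).filter fun w => w.1 0 1 ≠ 0) ∪
        ((commutingFinset A).filter fun w => w.1 1 0 ≠ 0)) ∪
      (((commutingFinset A).filter fun w => w.2 0 1 ≠ 0) ∪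
        ((commutingFinset A).filter fun w => w.2 1 0 ≠ 0)) ∪
      ((commutingFinset A).filter fun w =>
        (w.1 0 1 = 0 ∧ w.1 1 0 = 0) ∧ w.2 0 1 = 0 ∧ w.2 1 0 = 0) := by
    intro w hw
    simp only [Finset.mem_union, Finset.mem_filter, hw, true_and]
    tauto
  have hcard := Finset.card_le_card hcover
  have u1 := Finset.card_union_le
    ((((commutingFinset A).filter fun w => w.1 0 1 ≠ 0) ∪
        ((commutingFinset A).filter fun w => w.1 1 0 ≠ 0)) ∪
      (((commutingFinset A).filter fun w => w.2 0 1 ≠ 0) ∪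
        ((commutingFinset A).filter fun w => w.2 1 0 ≠ 0)))
    ((commutingFinset A).filter fun w =>
        (w.1 0 1 = 0 ∧ w.1 1 0 = 0) ∧ w.2 0 1 = 0 ∧ w.2 1 0 = 0)
  have u2 := Finset.card_union_le
    (((commutingFinset A).filter fun w => w.1 0 1 ≠ 0) ∪
        ((commutingFinset A).filter fun w => w.1 1 0 ≠ 0))
    (((commutingFinset A).filter fun w => w.2 0 1 ≠ 0) ∪
        ((commutingFinset A).filter fun w => w.2 1 0 ≠ 0))
  have u3 := Finset.card_union_le ((commutingFinset A).filter fun w => w.1 0 1 ≠ 0)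
    ((commutingFinset A).filter fun w => w.1 1 0 ≠ 0)
  have u4 := Finset.card_union_le ((commutingFinset A).filter fun w => w.2 0 1 ≠ 0)
    ((commutingFinset A).filter fun w => w.2 1 0 ≠ 0)
  have hT : commutingPairs A ≤ 4 * M + A.card ^ 4 := by
    rw [← card_commutingFinset]
    omega
  have hT' : (commutingPairs A : ℝ) ≤ 4 * M + (A.card : ℝ) ^ 4 := by exact_mod_cast hT
  have hpos : (1 : ℝ) ≤ ((A + A).card : ℝ) := by
    exact_mod_cast Finset.card_pos.2 (hA.add hA)
  have h5 : (A.card : ℝ) ^ 4 ≤ (A.card : ℝ) ^ 4 * ((A + A).card : ℝ) :=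
    le_mul_of_one_le_right (by positivity) hpos
  linarith

/-- Matrices with the same off-diagonal entries and the same difference of the diagonal entries
commute; the diagonals of such pairs are counted by the additive energy. -/
theorem sq_card_mul_addEnergy_le (A : Finset ℝ) :
    A.card ^ 2 * A.addEnergy A ≤ commutingPairs A := by
  classical
  rw [← card_commutingFinset, Finset.addEnergy, sq, ← Finset.card_product, ← Finset.card_product]
  refine Finset.card_le_card_of_injOn
    (fun u => (!![u.2.1.1, u.1.1; u.1.2, u.2.2.2], !![u.2.1.2, u.1.1; u.1.2, u.2.2.1])) ?_ ?_
  · rintro ⟨⟨b, c⟩, ⟨x, x'⟩, y, y'⟩ hu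
    simp only [Finset.coe_product, Finset.coe_filter, Set.mem_prod, Finset.mem_product,
      Set.mem_ofPred_eq, Finset.mem_coe] at hu
    obtain ⟨⟨hb, hc⟩, ⟨⟨hx, hx'⟩, hy, hy'⟩, h⟩ := hu
    rw [Finset.mem_coe, mem_commutingFinset, mul_comm_fin_two_iff (i := 0) (j := 1) (by decide)]
    refine ⟨⟨?_, ?_⟩, ?_, ?_, ?_⟩
    · simp [Fin.forall_fin_two, hb, hc, hx, hy']
    · simp [Fin.forall_fin_two, hb, hc, hx', hy]
    · simp [mul_comm]
    · simp only [Matrix.of_apply, Matrix.cons_val]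
      linear_combination b * h
    · simp only [Matrix.of_apply, Matrix.cons_val]
      linear_combination c * h
  · rintro ⟨⟨b, c⟩, ⟨x, x'⟩, y, y'⟩ - ⟨⟨b₁, c₁⟩, ⟨x₁, x₁'⟩, y₁, y₁'⟩ - h
    simp only [Prod.mk.injEq, ← Matrix.ext_iff, Fin.forall_fin_two, Matrix.of_apply,
      Matrix.cons_val] at h ⊢
    tauto

theorem card_pow_six_le (A : Finset ℝ) :
    A.card ^ 6 ≤ (A + A).card * commutingPairs A := by
  have h := A.le_card_add_mul_addEnergy A
  calc A.card ^ 6 = A.card ^ 2 * (A.card ^ 2 * A.card ^ 2) := by ring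
    _ ≤ A.card ^ 2 * ((A + A).card * A.addEnergy A) := Nat.mul_le_mul_left _ h
    _ = (A + A).card * (A.card ^ 2 * A.addEnergy A) := by ring
    _ ≤ _ := Nat.mul_le_mul_left _ (sq_card_mul_addEnergy_le A)

theorem corollary1p3 :
    ∃ C : ℝ, 0 < C ∧ ∀ (K : ℝ) (A : Finset ℝ), 1 < K → A.Nonempty →
      ((A + A).card : ℝ) = K * (A.card : ℝ) →
        K⁻¹ * (A.card : ℝ) ^ 5 ≤ (commutingPairs A : ℝ) ∧
        (commutingPairs A : ℝ) ≤ C * K ^ (4 / 3 : ℝ) * (A.card : ℝ) ^ 5 := by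
  refine ⟨2049, by norm_num, fun K A hK hA hcard => ?_⟩
  have hn : (0 : ℝ) < A.card := by exact_mod_cast Finset.card_pos.2 hA
  have hK0 : 0 < K := by linarith
  constructor
  · have h : (A.card : ℝ) ^ 6 ≤ ((A + A).card : ℝ) * commutingPairs A := by
      exact_mod_cast card_pow_six_le A
    rw [hcard] at h
    rw [inv_mul_le_iff₀ hK0]
    refine le_of_mul_le_mul_left ?_ hn
    linarith
  · have h := commutingPairs_le A hA
    -- The argument gives the exponent `1`, which is stronger since `K > 1`.
    have hKpow : K ≤ K ^ (4 / 3 : ℝ) := by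
      simpa using Real.rpow_le_rpow_of_exponent_le hK.le (by norm_num : (1 : ℝ) ≤ 4 / 3)
    calc (commutingPairs A : ℝ) ≤ 2049 * (A.card : ℝ) ^ 4 * (K * A.card) := by rwa [hcard] at h
      _ = 2049 * K * (A.card : ℝ) ^ 5 := by ring
      _ ≤ _ := by gcongr
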